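/- Let $n\ge 0$ and let $Q$ be a $\mathbb Z^n$-quiver: a quiver whose arrow set is partitioned into $n+1$ nonempty parts (arrow types) such that (1) exactly one arrow of each type leaves each vertex; (2) each vertex is connected to each other by a path missing at least one arrow type (an *admissible* path); (3) two paths $\gamma_1,\gamma_2$ leaving the same vertex arrive at the same vertex if and only if $\mathfrak t_{\gamma_1}-\mathfrak t_{\gamma_2}$ is constant, where $\mathfrak t_\gamma(\mathfrak a)$ is the number of arrows of type $\mathfrak a$ in $\gamma$. A path is *simple* if it contains at most one arrow of each type, and a *minimal circuit* is a simple path that is not admissible. Two distinct vertices are *neighbors* if a simple path connects the first to the second. A *polygon* is a nonempty set of pairwise neighboring vertices. Let $k$ be a field and $\mathfrak V$ a representation of $Q$ in a $k$-linear Abelian category, with objects $V_v$ and maps $\varphi_\gamma$ along paths $\gamma$. Assume that $\mathfrak V$ is - a *linked net*: if $\gamma_1,\gamma_2$ connect the same two vertices and $\gamma_2$ is admissible, then $\varphi_{\gamma_1}$ is a scalar multiple of $\varphi_{\gamma_2}$; $\varphi_\gamma=0$ for each minimal circuit $\gamma$; and $\operatorname{Ker}(\varphi_{\gamma_1})\cap\operatorname{Ker}(\varphi_{\gamma_2})=0$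 for each two admissible paths leaving the same vertex with no arrow type in common; - *simple*: every $V_v$ is a simple object; - *locally finite*: for each vertex $v$ there is an integer $\ell$ such that $\varphi_\mu=0$ for each path $\mu$ arriving at $v$ of length greater than $\ell$. A set $H$ of vertices *generates* $\mathfrak V$ if for each vertex $v$ there are finitely many paths $\gamma_1,\dots,\gamma_m$ from vertices of $H$ to $v$ with $V_v=\sum_i\operatorname{Im}(\varphi_{\gamma_i})$, and *$1$-generates* $\mathfrak V$ if for each $v$ there is a path $\gamma$ from a vertex of $H$ to $v$ with $\varphi_\gamma$ an epimorphism; it does so *minimally* if no proper subset of $H$ does. Neighbors $v_1,v_2$ are *unrelated* for $\mathfrak V$ if $\varphi_\gamma=0$ for every admissible path $\gamma$ connecting $v_1$ to $v_2$ or $v_2$ to $v_1$. A polygon is *unrelated* for $\mathfrak V$ if each two distinct vertices of it are unrelated (so a one-vertex polygon is unrelated). Then there is a polygon $\Delta$ of $Q$ which minimally generates $\mathfrak V$ and minimally $1$-generates $\mathfrak V$, and $\Delta$ is the only set of vertices that minimally generates, or minimally $1$-generates, $\mathfrak V$. Furthermore, $\Delta$ is finite and its size is the maximum of the sizes of the unrelated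 polygons for $\mathfrak V$. -/

import Mathlib

open CategoryTheory CategoryTheory.Limits Quiver

universe w u v₁ u₁ uk

section Paths

variable {V : Type u} [Quiver.{w} V] {n : ℕ}

/-- The number `t_γ(a)` of arrows of type `a` in the path `γ`, where the arrow set is partitioned
into `n + 1` parts by the function `τ` (the parts are the fibres of `τ`). -/
def typeCount (τ : ∀ ⦃x y : V⦄, (x ⟶ y) → Fin (n + 1)) {x : V} :
    ∀ {y : V}, Path x y → Fin (n + 1) → ℕ
  | _, Path.nil, _ => 0
  | _, Path.cons γ e, a => typeCount τ γ a + if τ e = a then 1 else 0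

/-- A path is admissible if it misses at least one arrow type. -/
def IsAdmissiblePath (τ : ∀ ⦃x y : V⦄, (x ⟶ y) → Fin (n + 1)) {x y : V} (γ : Path x y) : Prop :=
  ∃ a, typeCount τ γ a = 0

/-- A path is simple if it contains at most one arrow of each type. -/
def IsSimplePath (τ : ∀ ⦃x y : V⦄, (x ⟶ y) → Fin (n + 1)) {x y : V} (γ : Path x y) : Prop :=
  ∀ a, typeCount τ γ a ≤ 1

/-- A minimal circuit is a simple path that is not admissible. -/
def IsMinimalCircuit (τ : ∀ ⦃x y : V⦄, (x ⟶ y) → Fin (n + 1)) {x y : V} (γ : Path x y) : Prop :=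
  IsSimplePath τ γ ∧ ¬ IsAdmissiblePath τ γ

end Paths

/-- The structure of a `ℤⁿ`-quiver on the quiver `V`: a partition of the set of arrows into
`n + 1` nonempty parts (arrow types), subject to the three axioms of `ℤⁿ`-quivers. -/
structure ZnQuiver (V : Type u) [Quiver.{w} V] (n : ℕ) where
  /-- the type of an arrow -/
  arrowType : ∀ ⦃x y : V⦄, (x ⟶ y) → Fin (n + 1)
  /-- the parts of the partition are nonempty -/
  exists_arrow : ∀ a : Fin (n + 1), ∃ (x y : V) (e : x ⟶ y), arrowType e = a
  /-- exactly one arrow of each type leaves each vertex -/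
  existsUnique_arrow : ∀ (x : V) (a : Fin (n + 1)), ∃! e : (Σ y : V, (x ⟶ y)), arrowType e.2 = a
  /-- each vertex is connected to each other by an admissible path -/
  exists_admissible : ∀ x y : V, ∃ γ : Path x y, IsAdmissiblePath arrowType γ
  /-- two paths leaving the same vertex arrive at the same vertex if and only if the difference
  of their types is a constant function -/
  same_end_iff : ∀ (x y z : V) (γ₁ : Path x y) (γ₂ : Path x z),
    y = z ↔ ∃ c : ℤ, ∀ a, (typeCount arrowType γ₁ a : ℤ) - (typeCount arrowType γ₂ a : ℤ) = c

namespace ZnQuiver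

variable {V : Type u} [Quiver.{w} V] {n : ℕ} (Q : ZnQuiver V n)

/-- Two distinct vertices are neighbors if they are connected by a simple path. -/
def Neighbors (x y : V) : Prop :=
  x ≠ y ∧ ∃ γ : Path x y, IsSimplePath Q.arrowType γ

/-- A polygon is a nonempty collection of pairwise neighboring vertices. -/
def IsPolygon (Δ : Set V) : Prop :=
  Δ.Nonempty ∧ Δ.Pairwise Q.Neighbors

end ZnQuiver

section Representations

variable {V : Type u} [Quiver.{w} V] {C : Type u₁} [Category.{v₁} C]

/-- The composition `φ_γ` of the maps of the representation `R` along the path `γ`. -/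
def pathMap (R : V ⥤q C) {x y : V} (γ : Path x y) : R.obj x ⟶ R.obj y :=
  composePath (R.mapPath γ)

/-- A representation is simple if all associated objects are simple. -/
def IsSimpleRep [HasZeroMorphisms C] (R : V ⥤q C) : Prop :=
  ∀ x : V, Simple (R.obj x)

/-- A representation is locally finite if for each vertex `y` there is `ℓ` such that
the map along each path arriving at `y` with length greater than `ℓ` is zero. -/
def IsLocallyFinite [HasZeroMorphisms C] (R : V ⥤q C) : Prop :=
  ∀ y : V, ∃ ℓ : ℕ, ∀ (x : V) (μ : Path x y), ℓ < μ.length → pathMap R μ = 0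

/-- `R` is `1`-generated by `H` if for each vertex `y` some path from a vertex in `H` to `y`
induces an epimorphism. -/
def OneGenerates (R : V ⥤q C) (H : Set V) : Prop :=
  ∀ y : V, ∃ x ∈ H, ∃ γ : Path x y, Epi (pathMap R γ)

/-- `R` is generated by `H` if for each vertex `y` there are finitely many paths from vertices
in `H` to `y` such that the object at `y` is the sum of the images of the associated maps. -/
def Generates [Abelian C] (R : V ⥤q C) (H : Set V) : Prop :=
  ∀ y : V, ∃ S : Finset (Σ x : H, Path (x : V) y),
    S.sup (fun p => imageSubobject (pathMap R p.2)) = ⊤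

/-- Linked nets over a `ℤⁿ`-quiver in a `k`-linear Abelian category. -/
structure IsLinkedNet (k : Type uk) [Field k] [Abelian C] [Linear k C] {n : ℕ}
    (Q : ZnQuiver V n) (R : V ⥤q C) : Prop where
  smul_of_admissible : ∀ (x y : V) (γ₁ γ₂ : Path x y), IsAdmissiblePath Q.arrowType γ₂ →
    ∃ c : k, pathMap R γ₁ = c • pathMap R γ₂
  minimalCircuit_eq_zero : ∀ (x y : V) (γ : Path x y), IsMinimalCircuit Q.arrowType γ →
    pathMap R γ = 0
  kernel_inf_eq_bot : ∀ (x y z : V) (γ₁ : Path x y) (γ₂ : Path x z),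
    IsAdmissiblePath Q.arrowType γ₁ → IsAdmissiblePath Q.arrowType γ₂ →
    (∀ a, typeCount Q.arrowType γ₁ a = 0 ∨ typeCount Q.arrowType γ₂ a = 0) →
    kernelSubobject (pathMap R γ₁) ⊓ kernelSubobject (pathMap R γ₂) = ⊥

/-- The class `φ^x_y` of the maps along admissible paths from `x` to `y` is zero. (In a linked net
these maps are scalar multiples of each other, so this does not depend on the path.) -/
def AdmissibleMapEqZero [HasZeroMorphisms C] {n : ℕ} (Q : ZnQuiver V n) (R : V ⥤q C)
    (x y : V) : Prop :=
  ∀ γ : Path x y, IsAdmissiblePath Q.arrowType γ → pathMap R γ = 0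

/-- Unrelated neighbors: neighbors `x`, `y` such that `φ^x_y = 0` and `φ^y_x = 0`. -/
def UnrelatedNeighbors [HasZeroMorphisms C] {n : ℕ} (Q : ZnQuiver V n) (R : V ⥤q C)
    (x y : V) : Prop :=
  Q.Neighbors x y ∧ AdmissibleMapEqZero Q R x y ∧ AdmissibleMapEqZero Q R y x

/-- A polygon is unrelated if each two vertices of it are unrelated neighbors. -/
def IsUnrelatedPolygon [HasZeroMorphisms C] {n : ℕ} (Q : ZnQuiver V n) (R : V ⥤q C)
    (Δ : Set V) : Prop :=
  Q.IsPolygon Δ ∧ Δ.Pairwise (UnrelatedNeighbors Q R)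

end Representations

/-!
All objects of the representation are simple, so by Schur's lemma the map along a path is either
zero or an isomorphism. Say that `x` *reaches* `y` (`Reaches`) if some path from `x` to `y` has
nonzero map. In a linked net a path with nonzero map is admissible
(`IsLinkedNet.isAdmissiblePath`), and all admissible paths from `x` to `y` have nonzero map as soon
as one path does (`IsLinkedNet.pathMap_ne_zero`). Hence `Reaches` is a partial order on the
vertices, and local finiteness puts a minimal vertex below each vertex
(`exists_isSource_reaches`). A set of vertices generates, or `1`-generates, if and only if it has an
element below each vertex; so the set `Δ` of the minimal vertices is the only set that does so
minimally, and it remains to describe `Δ`.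

* `Δ` is a polygon (`IsLinkedNet.neighbors_of_isSource`). Let `x ≠ y` be minimal, let `t` be the
  type of an admissible path from `x` to `y`, and suppose that `t` takes a value at least `2`. Let
  `z` be the end of a path from `x` whose type is the indicator function of the support `I` of `t`.
  Then admissible paths from `z` to `y` and from `z` to `x` have types `t - 1_I` and `1_{Iᶜ}`, whose
  supports are disjoint. By the kernel condition `z` reaches `x` or `y`, although it differs from
  both, against minimality. So `t ≤ 1`.
* No unrelated polygon is larger than `Δ` (`IsLinkedNet.reaches_or_reaches`). If `w` reaches two
  neighbors `x` and `y`, then moving `w` along the part common to the two paths makes the types of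
  the paths disjoint. As `x` and `y` are neighbors, one of these types vanishes, so one of `x` and
  `y` reaches the other. Thus sending each vertex of an unrelated polygon to a minimal vertex below
  it is injective.
-/

/-! ### Paths in a `ℤⁿ`-quiver -/

section TypeCount

variable {V : Type u} [Quiver.{w} V] {n : ℕ}

theorem typeCount_comp (τ : ∀ ⦃x y : V⦄, (x ⟶ y) → Fin (n + 1)) {x y z : V} (p : Path x y)
    (q : Path y z) (a : Fin (n + 1)) :
    typeCount τ (p.comp q) a = typeCount τ p a + typeCount τ q a := by
  induction q with
  | nil => simp [typeCount]
  | cons q e ih => simp [typeCount, ih, add_assoc]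

end TypeCount

namespace ZnQuiver

variable {V : Type u} [Quiver.{w} V] {n : ℕ} (Q : ZnQuiver V n)

theorem end_eq {x y z : V} (p : Path x y) (q : Path x z)
    (h : ∀ a, typeCount Q.arrowType p a = typeCount Q.arrowType q a) : y = z :=
  (Q.same_end_iff x y z p q).2 ⟨0, fun a => by simp [h a]⟩

theorem exists_path_typeCount_eq (x : V) (t : Fin (n + 1) → ℕ) :
    ∃ (y : V) (p : Path x y), ∀ a, typeCount Q.arrowType p a = t a := by
  induction hN : ∑ a, t a generalizing t with
  | zero => exact ⟨x, Path.nil, fun a => by simp_all [typeCount]⟩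
  | succ N ih =>
    obtain ⟨b, -, hb⟩ : ∃ b ∈ Finset.univ, t b ≠ 0 :=
      Finset.exists_ne_zero_of_sum_ne_zero (by omega)
    have hsum : ∑ a, t a = ∑ a, (t a - if b = a then 1 else 0) + 1 := by
      have hone : ∑ a : Fin (n + 1), (if b = a then 1 else 0) = 1 := by simp
      refine Eq.trans ?_ (congrArg (_ + ·) hone)
      rw [← Finset.sum_add_distrib]
      refine Finset.sum_congr rfl fun a _ => ?_
      split_ifs with hab
      · subst hab; omega
      · omega
    obtain ⟨y, p, hp⟩ := ih (fun a => t a - if b = a then 1 else 0) (by omega)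
    obtain ⟨⟨z, e⟩, he, -⟩ := Q.existsUnique_arrow y b
    refine ⟨z, p.cons e, fun a => ?_⟩
    simp only at he
    simp only [typeCount, hp, he]
    split_ifs with hab
    · subst hab; omega
    · omega

/-- The arrows of a path can be reordered so that it begins with a subpath of any type bounded by
the type of the path. -/
theorem exists_comp_typeCount {x y : V} (p : Path x y) (m : Fin (n + 1) → ℕ)
    (hm : ∀ a, m a ≤ typeCount Q.arrowType p a) :
    ∃ (z : V) (q : Path x z) (r : Path z y), (∀ a, typeCount Q.arrowType q a = m a) ∧
      ∀ a, typeCount Q.arrowType r a = typeCount Q.arrowType p a - m a := by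
  obtain ⟨z, q, hq⟩ := Q.exists_path_typeCount_eq x m
  obtain ⟨y', r, hr⟩ := Q.exists_path_typeCount_eq z fun a => typeCount Q.arrowType p a - m a
  obtain rfl : y = y' := Q.end_eq p (q.comp r) fun a => by
    have := hm a
    rw [typeCount_comp, hq, hr]; omega
  exact ⟨z, q, r, hq, hr⟩

/-- Vertices that are pairwise neighbors are determined by the types of simple paths to them from
one of them, and there are finitely many such types. -/
theorem IsPolygon.finite {Δ : Set V} (h : Q.IsPolygon Δ) : Δ.Finite := by
  obtain ⟨⟨x, hx⟩, hΔ⟩ := h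
  have hex : ∀ y : V, ∃ t : Fin (n + 1) → ℕ, y ∈ Δ → (∀ a, t a ≤ 1) ∧
      ∃ p : Path x y, ∀ a, typeCount Q.arrowType p a = t a := by
    intro y
    by_cases hy : y ∈ Δ
    · by_cases hxy : x = y
      · subst hxy
        exact ⟨fun _ => 0, fun _ => ⟨fun _ => zero_le_one, Path.nil, fun _ => rfl⟩⟩
      · obtain ⟨p, hp⟩ := (hΔ hx hy hxy).2
        exact ⟨typeCount Q.arrowType p, fun _ => ⟨hp, p, fun _ => rfl⟩⟩
    · exact ⟨0, fun hy' => absurd hy' hy⟩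
  choose t ht using hex
  refine Set.Finite.of_finite_image (f := t)
    ((Set.finite_Iic (fun _ => 1 : Fin (n + 1) → ℕ)).subset ?_) ?_
  · rintro _ ⟨y, hy, rfl⟩
    exact (ht y hy).1
  · intro y hy z hz hyz
    obtain ⟨p, hp⟩ := (ht y hy).2
    obtain ⟨q, hq⟩ := (ht z hz).2
    exact Q.end_eq p q fun a => by rw [hp, hq, hyz]

end ZnQuiver

/-! ### Simple representations and the reachability relation -/

section Reaches

variable {V : Type u} [Quiver.{w} V] {C : Type u₁} [Category.{v₁} C]

theorem pathMap_comp (R : V ⥤q C) {x y z : V} (p : Path x y) (q : Path y z) :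
    pathMap R (p.comp q) = pathMap R p ≫ pathMap R q := by
  simp [pathMap]

theorem pathMap_cons (R : V ⥤q C) {x y z : V} (p : Path x y) (e : y ⟶ z) :
    pathMap R (p.cons e) = pathMap R p ≫ R.map e := by
  simp [pathMap]

/-- `x` reaches `y` if the map along some path from `x` to `y` is not zero. -/
def Reaches [HasZeroMorphisms C] (R : V ⥤q C) (x y : V) : Prop :=
  ∃ p : Path x y, pathMap R p ≠ 0

/-- A vertex is a source of the representation if it is minimal for reachability: no other vertex
reaches it. -/
def IsSource [HasZeroMorphisms C] (R : V ⥤q C) (x : V) : Prop :=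
  ∀ z : V, Reaches R z x → z = x

variable [Abelian C] {R : V ⥤q C}

namespace IsSimpleRep

/-- Schur's lemma. -/
theorem isIso_iff (hs : IsSimpleRep R) {x y : V} (f : R.obj x ⟶ R.obj y) : IsIso f ↔ f ≠ 0 :=
  haveI := hs x
  haveI := hs y
  isIso_iff_nonzero f

theorem epi_iff (hs : IsSimpleRep R) {x y : V} (f : R.obj x ⟶ R.obj y) : Epi f ↔ f ≠ 0 := by
  have := hs y
  refine ⟨?_, fun h => haveI := (hs.isIso_iff f).2 h; inferInstance⟩
  rintro h rfl
  exact id_nonzero (R.obj y) ((cancel_epi (0 : R.obj x ⟶ R.obj y)).1 (by simp))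

theorem pathMap_comp_ne_zero (hs : IsSimpleRep R) {x y z : V} {p : Path x y} {q : Path y z}
    (hp : pathMap R p ≠ 0) (hq : pathMap R q ≠ 0) : pathMap R (p.comp q) ≠ 0 := by
  rw [← hs.isIso_iff] at hp hq ⊢
  rw [pathMap_comp]
  infer_instance

theorem reaches_refl (hs : IsSimpleRep R) (x : V) : Reaches R x x :=
  haveI := hs x
  ⟨Path.nil, id_nonzero (R.obj x)⟩

theorem oneGenerates_iff (hs : IsSimpleRep R) (H : Set V) :
    OneGenerates R H ↔ ∀ y, ∃ x ∈ H, Reaches R x y := by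
  simp only [OneGenerates, Reaches, hs.epi_iff]

theorem generates_iff (hs : IsSimpleRep R) (H : Set V) :
    Generates R H ↔ ∀ y, ∃ x ∈ H, Reaches R x y := by
  refine forall_congr' fun y => ?_
  have := hs y
  constructor
  · rintro ⟨S, hS⟩
    by_contra! hH
    refine bot_ne_top (α := Subobject (R.obj y)) (hS ▸ ((Finset.sup_eq_bot_iff _ _).2 ?_).symm)
    rintro ⟨⟨x, hx⟩, p⟩ -
    have hp : pathMap R p = 0 := by
      by_contra hp
      exact hH x hx ⟨p, hp⟩
    simp only [hp, imageSubobject_zero]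
  · rintro ⟨x, hx, p, hp⟩
    have := (hs.epi_iff _).2 hp
    refine ⟨{⟨⟨x, hx⟩, p⟩}, ?_⟩
    rw [Finset.sup_singleton]
    have : IsIso (imageSubobject (pathMap R p)).arrow :=
      have := epi_of_epi_fac (imageSubobject_arrow_comp (pathMap R p))
      isIso_of_mono_of_epi _
    exact Subobject.eq_top_of_isIso_arrow _

end IsSimpleRep

/-- A nonzero path of maximal length ending at `y` starts at a source. -/
theorem exists_isSource_reaches (hs : IsSimpleRep R) (hfin : IsLocallyFinite R) (y : V) :
    ∃ x, IsSource R x ∧ Reaches R x y := by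
  classical
  obtain ⟨l, hl⟩ := hfin y
  let P : ℕ → Prop := fun m => ∃ (x : V) (p : Path x y), p.length = m ∧ pathMap R p ≠ 0
  have hbound : ∀ m, P m → m ≤ l := by
    rintro _ ⟨x, p, rfl, hp⟩
    by_contra! h
    exact hp (hl x p h)
  obtain ⟨p₀, hp₀⟩ := hs.reaches_refl y
  have h₀ : P p₀.length := ⟨y, p₀, rfl, hp₀⟩
  obtain ⟨x, p, hlen, hp⟩ := Nat.findGreatest_spec (hbound _ h₀) h₀
  refine ⟨x, ?_, p, hp⟩
  rintro z ⟨q, hq⟩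
  have hqp := hs.pathMap_comp_ne_zero hq hp
  have hP : P (q.comp p).length := ⟨z, q.comp p, rfl, hqp⟩
  have hle := Nat.le_findGreatest (hbound _ hP) hP
  rw [Path.length_comp] at hle
  exact Path.eq_of_length_zero q (by omega)

end Reaches

/-! ### Linked nets of simple objects -/

namespace IsLinkedNet

variable {k : Type uk} [Field k] {C : Type u₁} [Category.{v₁} C] [Abelian C] [Linear k C]
  {V : Type u} [Quiver.{w} V] {n : ℕ} {Q : ZnQuiver V n} {R : V ⥤q C}

/-- If a path just fails to be admissible, its arrows before the last one can be reordered, at the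
cost of a scalar, so that it ends with a minimal circuit. -/
theorem isAdmissiblePath (hR : IsLinkedNet k Q R) {x y : V} (p : Path x y)
    (hp : pathMap R p ≠ 0) : IsAdmissiblePath Q.arrowType p := by
  induction p with
  | nil => exact ⟨0, rfl⟩
  | @cons y z p e ih =>
    rw [pathMap_cons] at hp
    obtain ⟨a, ha⟩ := ih fun h => hp (by rw [h, zero_comp])
    by_contra hadm
    have hpos : ∀ b, typeCount Q.arrowType (p.cons e) b ≠ 0 := fun b hb => hadm ⟨b, hb⟩
    simp only [typeCount] at hpos
    have hea : Q.arrowType e = a := by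
      by_contra h
      exact hpos a (by simp [ha, h])
    obtain ⟨v, q, r, hq, hr⟩ := Q.exists_comp_typeCount p
      (fun b => typeCount Q.arrowType p b - if a = b then 0 else 1) fun b => Nat.sub_le _ _
    obtain ⟨c, hc⟩ := hR.smul_of_admissible x y p (q.comp r)
      ⟨a, by rw [typeCount_comp, hq, hr]; omega⟩
    have hcirc : pathMap R (r.cons e) = 0 := by
      have hone : ∀ b, typeCount Q.arrowType (r.cons e) b = 1 := by
        intro b
        have := hpos b
        simp only [typeCount, hr, hea] at this ⊢
        split_ifs at this ⊢ with hab
        · subst hab; omega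
        · omega
      refine hR.minimalCircuit_eq_zero _ _ _ ⟨fun b => (hone b).le, ?_⟩
      rintro ⟨b, hb⟩
      simp [hone] at hb
    rw [pathMap_cons] at hcirc
    exact hp (by rw [hc, pathMap_comp, Linear.smul_comp, Category.assoc, hcirc]; simp)

theorem pathMap_ne_zero (hR : IsLinkedNet k Q R) {x y : V} (h : Reaches R x y) (p : Path x y)
    (hp : IsAdmissiblePath Q.arrowType p) : pathMap R p ≠ 0 := by
  obtain ⟨q, hq⟩ := h
  obtain ⟨c, hc⟩ := hR.smul_of_admissible x y q p hp
  intro h0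
  exact hq (by rw [hc, h0, smul_zero])

/-- Two admissible paths without common arrow types leaving a vertex cannot both have zero map,
because the kernel of a zero map is the whole nonzero object. -/
theorem reaches_or_reaches_of_disjoint (hR : IsLinkedNet k Q R) (hs : IsSimpleRep R) {x y z : V}
    (p : Path x y) (q : Path x z) (hp : IsAdmissiblePath Q.arrowType p)
    (hq : IsAdmissiblePath Q.arrowType q)
    (hpq : ∀ a, typeCount Q.arrowType p a = 0 ∨ typeCount Q.arrowType q a = 0) :
    Reaches R x y ∨ Reaches R x z := by
  have := hs x
  by_contra! h
  have hp0 : pathMap R p = 0 := by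
    by_contra h0
    exact h.1 ⟨p, h0⟩
  have hq0 : pathMap R q = 0 := by
    by_contra h0
    exact h.2 ⟨q, h0⟩
  have hker := hR.kernel_inf_eq_bot x y z p q hp hq hpq
  rw [hp0, hq0, kernelSubobject_zero, kernelSubobject_zero, inf_top_eq] at hker
  exact bot_ne_top hker.symm

theorem neighbors_of_isSource (hR : IsLinkedNet k Q R) (hs : IsSimpleRep R) {x y : V}
    (hx : IsSource R x) (hy : IsSource R y) (hxy : x ≠ y) : Q.Neighbors x y := by
  obtain ⟨p, a₀, ha₀⟩ := Q.exists_admissible x y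
  refine ⟨hxy, p, fun b => ?_⟩
  by_contra! hb
  -- `z` is the end of a path from `x` containing each arrow type occurring in `p` exactly once.
  obtain ⟨z, q, r, hq, hr⟩ := Q.exists_comp_typeCount p
    (fun a => min (typeCount Q.arrowType p a) 1) fun a => min_le_left _ _
  -- `s` completes `q` to a circuit.
  obtain ⟨x', s, hs'⟩ := Q.exists_path_typeCount_eq z
    fun a => 1 - min (typeCount Q.arrowType p a) 1
  obtain rfl : x = x' := (Q.same_end_iff x x x' Path.nil (q.comp s)).2 ⟨-1, fun a => by
    rw [typeCount_comp, hq, hs']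
    simp only [typeCount]
    omega⟩
  rcases hR.reaches_or_reaches_of_disjoint hs r s ⟨a₀, by rw [hr]; omega⟩
    ⟨b, by rw [hs']; omega⟩ (fun a => by rw [hr, hs']; omega) with h | h
  · obtain rfl := hy z h
    -- `r` is a circuit, so its type is constant; but it contains arrows of type `b`, none of `a₀`.
    obtain ⟨c, hc⟩ := (Q.same_end_iff z z z r Path.nil).1 rfl
    have h1 := hc a₀
    have h2 := hc b
    rw [hr] at h1 h2
    simp only [typeCount] at h1 h2
    omega
  · obtain rfl := hx z h
    obtain ⟨c, hc⟩ := (Q.same_end_iff z z z q Path.nil).1 rfl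
    have h1 := hc a₀
    have h2 := hc b
    rw [hq] at h1 h2
    simp only [typeCount] at h1 h2
    omega

/-- Neighbors reached from a common vertex are comparable for reachability. -/
theorem reaches_or_reaches (hR : IsLinkedNet k Q R) {w x y : V} (hxy : Q.Neighbors x y)
    (hx : Reaches R w x) (hy : Reaches R w y) : Reaches R x y ∨ Reaches R y x := by
  obtain ⟨-, g, hg⟩ := hxy
  obtain ⟨p, hp⟩ := hx
  obtain ⟨q, hq⟩ := hy
  obtain ⟨v, p₁, p₂, hp₁, hp₂⟩ := Q.exists_comp_typeCount p
    (fun a => min (typeCount Q.arrowType p a) (typeCount Q.arrowType q a)) fun a => min_le_left _ _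
  obtain ⟨v', q₁, q₂, hq₁, hq₂⟩ := Q.exists_comp_typeCount q
    (fun a => min (typeCount Q.arrowType p a) (typeCount Q.arrowType q a)) fun a => min_le_right _ _
  obtain rfl : v = v' := Q.end_eq p₁ q₁ fun a => by rw [hp₁, hq₁]
  obtain ⟨ap, hap⟩ := hR.isAdmissiblePath p hp
  obtain ⟨aq, haq⟩ := hR.isAdmissiblePath q hq
  have hvx : pathMap R p₂ ≠ 0 := by
    intro h0
    refine hR.pathMap_ne_zero ⟨p, hp⟩ (p₁.comp p₂)
      ⟨ap, by rw [typeCount_comp, hp₁, hp₂]; omega⟩ ?_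
    rw [pathMap_comp, h0, comp_zero]
  have hvy : pathMap R q₂ ≠ 0 := by
    intro h0
    refine hR.pathMap_ne_zero ⟨q, hq⟩ (q₁.comp q₂)
      ⟨aq, by rw [typeCount_comp, hq₁, hq₂]; omega⟩ ?_
    rw [pathMap_comp, h0, comp_zero]
  obtain ⟨c, hc⟩ := (Q.same_end_iff v y y (p₂.comp g) q₂).1 rfl
  simp only [typeCount_comp, hp₂, hq₂] at hc
  by_cases hzero : ∀ a, typeCount Q.arrowType p₂ a = 0
  · obtain rfl : v = x := Q.end_eq Path.nil p₂ fun a => (hzero a).symm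
    exact Or.inl ⟨q₂, hvy⟩
  · -- The types of `p₂` and `q₂` have disjoint supports and, as `g` is simple, the values of their
    -- difference differ by at most one. So if `p₂` has an arrow then `q₂` has none.
    push Not at hzero
    obtain ⟨b, hb⟩ := hzero
    obtain rfl : v = y := Q.end_eq Path.nil q₂ fun a => by
      have h1 := hc a
      have h2 := hc b
      have h3 := hg a
      have h4 := hg b
      rw [hp₂] at hb
      rw [hq₂]
      simp only [typeCount]
      omega
    exact Or.inr ⟨p₂, hvx⟩

end IsLinkedNet

/-! ### The minimal generating polygon -/

/-- The least element of the sets satisfying `P` is the only minimal one. -/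
theorem minimal_iff_eq_of_forall_subset {α : Type*} {P : Set α → Prop} {D : Set α} (hD : P D)
    (h : ∀ H, P H → D ⊆ H) (H : Set α) : Minimal P H ↔ H = D := by
  refine ⟨fun hH => (hH.eq_of_subset hD (h H hH.prop)).symm, ?_⟩
  rintro rfl
  exact ⟨hD, fun K hK _ => h K hK⟩

theorem mainTheorem5 {k : Type uk} [Field k] {C : Type u₁} [Category.{v₁} C] [Abelian C]
    [Linear k C] {V : Type u} [Quiver.{w} V] {n : ℕ} (Q : ZnQuiver V n) (R : V ⥤q C)
    (hR : IsLinkedNet k Q R) (hsimple : IsSimpleRep R) (hfin : IsLocallyFinite R) :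
    ∃ Δ : Set V, Q.IsPolygon Δ ∧
      Minimal (Generates R) Δ ∧ Minimal (OneGenerates R) Δ ∧
      (∀ H : Set V, Minimal (Generates R) H ∨ Minimal (OneGenerates R) H → H = Δ) ∧
      Δ.Finite ∧
      IsGreatest (Set.encard '' {Γ : Set V | IsUnrelatedPolygon Q R Γ}) Δ.encard := by
  have hcover : ∀ y, ∃ x ∈ {x | IsSource R x}, Reaches R x y :=
    exists_isSource_reaches hsimple hfin
  have hleast : ∀ H : Set V, (∀ y, ∃ x ∈ H, Reaches R x y) → {x | IsSource R x} ⊆ H := by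
    intro H hH y hy
    obtain ⟨x, hx, hxy⟩ := hH y
    exact hy x hxy ▸ hx
  have hgen := minimal_iff_eq_of_forall_subset ((hsimple.generates_iff _).2 hcover)
    fun H hH => hleast H ((hsimple.generates_iff H).1 hH)
  have hone := minimal_iff_eq_of_forall_subset ((hsimple.oneGenerates_iff _).2 hcover)
    fun H hH => hleast H ((hsimple.oneGenerates_iff H).1 hH)
  have hpoly : Q.IsPolygon {x | IsSource R x} := by
    obtain ⟨v, -, -, -⟩ := Q.exists_arrow 0
    obtain ⟨x, hx, -⟩ := hcover v
    exact ⟨⟨x, hx⟩, fun x hx y hy hxy => hR.neighbors_of_isSource hsimple hx hy hxy⟩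
  have hzero : ∀ x y, x ≠ y → IsSource R y → AdmissibleMapEqZero Q R x y := by
    intro x y hxy hy p _
    by_contra hp
    exact hxy (hy x ⟨p, hp⟩)
  refine ⟨{x | IsSource R x}, hpoly, (hgen _).2 rfl, (hone _).2 rfl,
    fun H hH => hH.elim (hgen H).1 (hone H).1, hpoly.finite, ⟨_, ⟨hpoly, ?_⟩, rfl⟩, ?_⟩
  · exact fun x hx y hy hxy => ⟨hpoly.2 hx hy hxy, hzero x y hxy hy, hzero y x hxy.symm hx⟩
  · rintro _ ⟨Γ, hΓ, rfl⟩
    choose s hs hreach using hcover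
    refine Set.encard_le_encard_of_injOn (f := s) (fun x _ => hs x) fun x hx y hy hxy => ?_
    by_contra hne
    obtain ⟨hnb, h₁, h₂⟩ := hΓ.2 hx hy hne
    rcases hR.reaches_or_reaches hnb (hreach x) (hxy ▸ hreach y) with ⟨p, hp⟩ | ⟨p, hp⟩
    · exact hp (h₁ p (hR.isAdmissiblePath p hp))
    · exact hp (h₂ p (hR.isAdmissiblePath p hp))
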